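/- Let $p$ be a prime, $N\in\mathbb{N}$, $\mathcal{A}_N=\{1,\dots,N\}$, and let $w=a_1a_2a_3\ldots\in\mathcal{A}_N^{\mathbb{N}}$ be an infinite word that is non-periodic and uniformly recurrent, i.e. every factor (finite block) $u$ of $w$ occurs infinitely often in $w$, and the distance between any two consecutive occurrences of $u$ is bounded by a constant $d=d(u)$. For each $n$ let $G_n$ be the bipartite graph whose two vertex classes $S_n$ and $T_n$ are disjoint copies of the set of factors of $w$ of length $n$, in which $s\in S_n$ and $t\in T_n$ are joined by an edge if and only if the concatenation $st$ is a factor of $w$. For $a\in\mathbb{N}$ put $A_a=\begin{pmatrix}0&1\\1&a\end{pmatrix}$. For an infinite word $v=b_1b_2b_3\ldots$ over the positive integers and a point $\mathbf q\in\mathbf{P}^1_{\mathbb{Q}_p}$ (regarded as a column of homogeneous coordinates) put $\mathrm{T}(v,\mathbf q)=(b_2b_3\ldots,\,A_{b_1}\mathbf q)$. For $\epsilon>0$ let $\mathbf{PBad}_\epsilon$ be the set of points $(q_1,q_2)\in\mathbf{P}^1_{\mathbb{Q}_p}$ such that $$|aq_1+bq_2|_p\cdot\min\{|q_1|_p^{-1},|q_2|_p^{-1}\}\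 \ge\ \epsilon\cdot\min\{|a|^{-2},|b|^{-2}\}\qquad\text{for all }(a,b)\in\mathbb{Z}^2\setminus\{(0,0)\},$$ where the inverse of $0$ is read as $+\infty$. Let $\mathbf{LMad}$ be the set of pairs $(v,\mathbf x_p)$ for which there is an $\epsilon>0$ such that $\mathrm{T}^n(v,\mathbf x_p)\in\mathcal{A}_M^{\mathbb{N}}\times\mathbf{PBad}_\epsilon$ for every $n\ge 0$, where $M=\lfloor\epsilon^{-1}\rfloor+1$. If the number of connected components of $G_n$ is bounded by a constant independent of $n$, then $(w,\mathbf x_p)\notin\mathbf{LMad}$ for every $\mathbf x_p\in\mathbf{P}^1_{\mathbb{Q}_p}$. -/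

import Mathlib

namespace LimitWords

/-! ### Infinite words -/

/-- The finite alphabet `{1, 2, …, N}`. -/
def alphabet (N : ℕ) : Set ℕ := Set.Icc 1 N

/-- The set of infinite words over the alphabet `{1, …, N}`.
An infinite word `a₁ a₂ a₃ …` is the function `w : ℕ → ℕ` with `w i = a_{i+1}`. -/
def wordsOver (N : ℕ) : Set (ℕ → ℕ) := {w | ∀ i, w i ∈ alphabet N}

/-- The left shift on infinite words. -/
def shift (w : ℕ → ℕ) : ℕ → ℕ := fun i => w (i + 1)

/-- The finite word `u` occurs in the infinite word `w` at position `i`. -/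
def OccursAt (w : ℕ → ℕ) (u : List ℕ) (i : ℕ) : Prop :=
  ∀ (j : ℕ) (hj : j < u.length), w (i + j) = u[j]

/-- The finite word `u` is a factor of the infinite word `w`. -/
def IsFactor (w : ℕ → ℕ) (u : List ℕ) : Prop := ∃ i, OccursAt w u i

/-- `w` is (purely) periodic. -/
def IsPeriodic (w : ℕ → ℕ) : Prop := ∃ l : ℕ, 0 < l ∧ Function.Periodic w l

/-- `w` is recurrent: every factor of `w` occurs infinitely often in `w`. -/
def IsRecurrent (w : ℕ → ℕ) : Prop :=
  ∀ u : List ℕ, IsFactor w u → {i | OccursAt w u i}.Infinite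

/-- `w` is uniformly recurrent: it is recurrent, and for each factor `u` the distance between
any two consecutive occurrences of `u` in `w` is at most a constant `d = d(u)`. -/
def IsUniformlyRecurrent (w : ℕ → ℕ) : Prop :=
  IsRecurrent w ∧
    ∀ u : List ℕ, IsFactor w u → ∃ d : ℕ, ∀ i j : ℕ, i < j →
      OccursAt w u i → OccursAt w u j → (∀ k, i < k → k < j → ¬ OccursAt w u k) →
        j - i ≤ d

/-! ### The bipartite graphs of a word -/

/-- The set of factors of `w` of length `n`. -/
def factors (w : ℕ → ℕ) (n : ℕ) : Set (List ℕ) := {u | u.length = n ∧ IsFactor w u}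

/-- The bipartite graph `G_n`: its two vertex classes are two disjoint copies of the set of factors
of `w` of length `n`; the vertex `s` of the first copy and the vertex `t` of the second one are
linked iff the concatenation `st` is a factor of `w`, and there are no other edges. -/
def factorGraph (w : ℕ → ℕ) (n : ℕ) : SimpleGraph (factors w n ⊕ factors w n) where
  Adj x y :=
    (∃ s t : factors w n, x = Sum.inl s ∧ y = Sum.inr t ∧ IsFactor w (s.1 ++ t.1)) ∨
    (∃ s t : factors w n, y = Sum.inl s ∧ x = Sum.inr t ∧ IsFactor w (s.1 ++ t.1))
  symm := ⟨fun _ _ h => h.symm⟩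
  loopless := ⟨by
    rintro x (⟨s, t, h1, h2, -⟩ | ⟨s, t, h1, h2, -⟩) <;> rw [h1] at h2 <;> cases h2⟩

/-! ### The projective line over `ℚ_p` and the extended shift -/

section Padic

variable (p : ℕ) [Fact p.Prime]

/-- The projective line over `ℚ_p`. -/
abbrev PLine : Type := Projectivization ℚ_[p] (Fin 2 → ℚ_[p])

/-- The matrix `A_a` with rows `(0, 1)` and `(1, a)`. -/
noncomputable def matA (a : ℕ) : Matrix (Fin 2) (Fin 2) ℚ_[p] := !![0, 1; 1, (a : ℚ_[p])]

theorem matA_mulVecLin_injective (a : ℕ) : Function.Injective (matA p a).mulVecLin := by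
  intro u v h
  have h0 := congrFun h 0
  have h1 := congrFun h 1
  simp only [matA, Matrix.mulVecLin_apply, Matrix.mulVec, dotProduct, Fin.sum_univ_two,
    Matrix.of_apply, Matrix.cons_val_zero, Matrix.cons_val_one, Matrix.cons_val', zero_mul,
    one_mul, zero_add, Matrix.cons_val_fin_one] at h0 h1
  rw [h0] at h1
  funext i
  fin_cases i
  · exact add_right_cancel h1
  · exact h0

/-- The action `q ↦ A_a q` on the projective line. -/
noncomputable def actA (a : ℕ) : PLine p → PLine p :=
  Projectivization.map (matA p a).mulVecLin (matA_mulVecLin_injective p a)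

/-- The extended shift `T (w, q) = (T w, A_{a₁} q)`, where `a₁` is the first letter of `w`. -/
noncomputable def extShift (x : (ℕ → ℕ) × PLine p) : (ℕ → ℕ) × PLine p :=
  (shift x.1, actA p (x.1 0) x.2)

/-- The inequality defining badly approximable points, for a vector `v = (q₁, q₂)`:
for all integers `(a, b) ≠ (0, 0)`,
`|a q₁ + b q₂|_p * min (|q₁|_p⁻¹, |q₂|_p⁻¹) ≥ min (|a|⁻², |b|⁻²) * ε`.
The inverse of `0` is to be read as `∞` here, so that the two minima are
`(max (|q₁|_p, |q₂|_p))⁻¹` and `(max (|a|, |b|))⁻²`. -/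
def BadVec (ε : ℝ) (v : Fin 2 → ℚ_[p]) : Prop :=
  ∀ a b : ℤ, (a, b) ≠ (0, 0) →
    ‖(a : ℚ_[p]) * v 0 + (b : ℚ_[p]) * v 1‖ * (max ‖v 0‖ ‖v 1‖)⁻¹ ≥
      ((max |(a : ℝ)| |(b : ℝ)|) ^ 2)⁻¹ * ε

/-- The set `PBad_ε` of `p`-adically badly approximable points with constant `ε`. The condition
does not depend on the choice of homogeneous coordinates, see `mk_mem_PBad_iff`. -/
def PBad (ε : ℝ) : Set (PLine p) := {q | BadVec p ε q.rep}

theorem badVec_smul_iff (ε : ℝ) (c : ℚ_[p]) (hc : c ≠ 0) (v : Fin 2 → ℚ_[p]) :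
    BadVec p ε (c • v) ↔ BadVec p ε v := by
  have hc' : ‖c‖ ≠ 0 := norm_ne_zero_iff.mpr hc
  have key : ∀ a b : ℤ,
      ‖(a : ℚ_[p]) * (c • v) 0 + (b : ℚ_[p]) * (c • v) 1‖ *
          (max ‖(c • v) 0‖ ‖(c • v) 1‖)⁻¹ =
        ‖(a : ℚ_[p]) * v 0 + (b : ℚ_[p]) * v 1‖ * (max ‖v 0‖ ‖v 1‖)⁻¹ := by
    intro a b
    have e1 : (a : ℚ_[p]) * (c • v) 0 + (b : ℚ_[p]) * (c • v) 1
        = c * ((a : ℚ_[p]) * v 0 + (b : ℚ_[p]) * v 1) := by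
      simp only [Pi.smul_apply, smul_eq_mul]; ring
    rw [e1]
    simp only [Pi.smul_apply, smul_eq_mul, norm_mul]
    rw [← mul_max_of_nonneg _ _ (norm_nonneg c), mul_inv, mul_mul_mul_comm,
      mul_inv_cancel₀ hc', one_mul]
  simp only [BadVec, key]

theorem mk_mem_PBad_iff (ε : ℝ) (v : Fin 2 → ℚ_[p]) (hv : v ≠ 0) :
    Projectivization.mk ℚ_[p] v hv ∈ PBad p ε ↔ BadVec p ε v := by
  obtain ⟨c, hc⟩ := Projectivization.exists_smul_eq_mk_rep ℚ_[p] v hv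
  change BadVec p ε _ ↔ _
  rw [← hc]
  exact badVec_smul_iff p ε c c.ne_zero v

/-- The set `LMad_ε` of pairs `(w, x_p)` such that `T^n (w, x_p) ∈ {1, …, N}^ℕ × PBad_ε` for
every `n`, where `N = [ε⁻¹] + 1`. -/
def LMadEps (ε : ℝ) : Set ((ℕ → ℕ) × PLine p) :=
  {x | ∀ n : ℕ, (extShift p)^[n] x ∈ wordsOver (⌊ε⁻¹⌋₊ + 1) ×ˢ PBad p ε}

/-- The set `LMad`, the union of the sets `LMad_ε` over `ε > 0`. -/
def LMad : Set ((ℕ → ℕ) × PLine p) := {x | ∃ ε : ℝ, 0 < ε ∧ x ∈ LMadEps p ε}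

end Padic

end LimitWords

/-!
Let `u n` be the orbit of an integral vector representing `x` under the matrices of the letters of
`w`. Modulo `p ^ k` the orbit takes finitely many values, and the values which it takes at the
occurrences of the block of length `n` at `i` decrease, as `n` grows, to a set, the fibre at `i`.
By uniform recurrence the decrease stops at an `n` independent of `i`; then the fibre at the
boundary between two adjacent blocks of length `n` is determined by either of them, and hence by
their connected component in `G_n`. With boundedly many components there are therefore infinitely
many positions whose fibres agree modulo every power of `p`.

If `i < j` are two such positions, the matrix `M` of the block between them permutes the fibres at
`i`, so that every `M ^ e (u i)` is a `p`-adic limit of points of the orbit. If `u i` is not an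
eigenvector of `M`, write `M ^ m = 1 + p ^ 2 Y`; then some integral linear form takes arbitrarily
small values at the vectors `(1 + p ^ 2 Y) ^ l (u i)`, the digits of `l` being found one at a time,
and the orbit is not uniformly badly approximable. So `u i` is an eigenvector of the matrices of all
these blocks. Its slope being irrational, they commute, and since the matrix of a block determines
the block, the blocks commute too, which makes `w` periodic.
-/

open scoped Polynomial

namespace LimitWords

/-- The block of length `n` of `w` at the position `i`, that is, `w i, …, w (i + n - 1)`. -/
def block (w : ℕ → ℕ) (i n : ℕ) : List ℕ := (List.range' i n).map w

section Block

variable {w : ℕ → ℕ} {i j m n : ℕ}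

@[simp]
theorem length_block (w : ℕ → ℕ) (i n : ℕ) : (block w i n).length = n := by simp [block]

theorem block_succ (w : ℕ → ℕ) (i n : ℕ) : block w i (n + 1) = w i :: block w (i + 1) n := rfl

theorem block_add (w : ℕ → ℕ) (i m n : ℕ) :
    block w i (m + n) = block w i m ++ block w (i + m) n := by
  simp only [block, ← List.map_append, List.range'_append_1]

theorem block_eq_of_le (h : block w i n = block w j n) (hmn : m ≤ n) :
    block w i m = block w j m := by
  obtain ⟨k, rfl⟩ := Nat.exists_eq_add_of_le hmn
  rw [block_add, block_add] at h
  exact List.append_inj_left h (by simp only [length_block])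

theorem apply_add_eq_of_block_eq (h : block w i n = block w j n) {t : ℕ} (ht : t < n) :
    w (i + t) = w (j + t) := by
  have := List.getElem_of_eq h (i := t) (by simpa)
  simpa [block] using this

theorem forall_mem_block {P : ℕ → Prop} (h : ∀ i, P (w i)) : ∀ a ∈ block w i n, P a := by
  simp only [block, List.forall_mem_map]
  exact fun j _ => h j

theorem occursAt_iff_block_eq {u : List ℕ} : OccursAt w u i ↔ block w i u.length = u := by
  simp [List.ext_getElem_iff, OccursAt, block]

theorem block_mem_factors (w : ℕ → ℕ) (i n : ℕ) : block w i n ∈ factors w n :=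
  ⟨length_block w i n, i, occursAt_iff_block_eq.2 (by rw [length_block])⟩

theorem IsUniformlyRecurrent.exists_occursAt {u : List ℕ} (hw : IsUniformlyRecurrent w)
    (hu : IsFactor w u) : ∃ D, ∀ a, ∃ m ≤ D, OccursAt w u (a + m) := by
  classical
  obtain ⟨d, hd⟩ := hw.2 u hu
  obtain ⟨i, hi⟩ := id hu
  refine ⟨max d i, fun a => ?_⟩
  induction a with
  | zero => exact ⟨i, le_max_right d i, by rwa [zero_add]⟩
  | succ a ih =>
    obtain ⟨_ | m, hm, ha⟩ := ih
    · have hnext : ∃ b, a < b ∧ OccursAt w u b := by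
        obtain ⟨b, hb, hab⟩ := (hw.1 u hu).exists_gt a
        exact ⟨b, hab, hb⟩
      obtain ⟨hab, hb⟩ := Nat.find_spec hnext
      have hgap := hd a _ hab ha hb fun k hak hkb hk => Nat.find_min hnext hkb ⟨hak, hk⟩
      exact ⟨Nat.find hnext - (a + 1), by omega, by rwa [Nat.add_sub_cancel' hab]⟩
    · exact ⟨m, by omega, by rwa [add_right_comm]⟩

theorem IsUniformlyRecurrent.exists_block_eq (hw : IsUniformlyRecurrent w) (i n : ℕ) :
    ∃ D, ∀ a, ∃ m ≤ D, block w (a + m) n = block w i n := by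
  simpa only [occursAt_iff_block_eq, length_block] using
    hw.exists_occursAt (block_mem_factors w i n).2

theorem IsRecurrent.isPeriodic (hw : IsRecurrent w) {l : ℕ} (hl : 0 < l)
    (h : ∀ t, w (i + t + l) = w (i + t)) : IsPeriodic w := by
  refine ⟨l, hl, fun a => ?_⟩
  obtain ⟨b, hb, hib⟩ := (hw _ (block_mem_factors w a (l + 1)).2).exists_gt i
  have hblock : block w b (l + 1) = block w a (l + 1) := by
    simpa only [Set.mem_ofPred_eq, occursAt_iff_block_eq, length_block] using hb
  have hper := h (b - i)
  rw [Nat.add_sub_cancel' hib.le, apply_add_eq_of_block_eq hblock l.lt_succ_self] at hper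
  exact hper.trans (apply_add_eq_of_block_eq hblock l.succ_pos)

end Block

/-! ### Fibres of a sequence over a word -/

section Fiber

variable {Z : Type*} {w : ℕ → ℕ} {z : ℕ → Z}

/-- The values of `z` at the occurrences in `w` of the block of length `n` at the position `i`. -/
def blockSet (w : ℕ → ℕ) (z : ℕ → Z) (i n : ℕ) : Set Z := z '' {j | block w j n = block w i n}

/-- The fibre of `z` over the point `w i, w (i + 1), …` of the word: the values which `z` takes at
occurrences of arbitrarily long blocks at the position `i`. -/
def fiber (w : ℕ → ℕ) (z : ℕ → Z) (i : ℕ) : Set Z := ⋂ n, blockSet w z i n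

theorem blockSet_antitone (i : ℕ) : Antitone (blockSet w z i) :=
  fun _ _ hmn => Set.image_mono fun _ hj => block_eq_of_le hj hmn

theorem blockSet_congr {i j n : ℕ} (h : block w i n = block w j n) :
    blockSet w z i n = blockSet w z j n := by
  simp only [blockSet, h]

theorem mem_fiber_self (w : ℕ → ℕ) (z : ℕ → Z) (i : ℕ) : z i ∈ fiber w z i :=
  Set.mem_iInter.2 fun _ => ⟨i, rfl, rfl⟩

theorem fiber_comp {Z' : Type*} (f : Z → Z') {i n : ℕ} (h : blockSet w z i n = fiber w z i) :
    fiber w (f ∘ z) i = f '' fiber w z i := by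
  have himage : ∀ m, blockSet w (f ∘ z) i m = f '' blockSet w z i m :=
    fun m => Set.image_comp f z _
  simp only [fiber, himage]
  refine subset_antisymm ?_ (Set.image_iInter_subset _ f)
  rw [← fiber, ← h]
  exact Set.iInter_subset _ n

/-- The colouring of the graph `G_n` which gives to a vertex the values of `z` at the boundary
between its two sides: at the ends of the occurrences of a word in the left class, and at the
beginnings of those of a word in the right class. -/
def boundaryColor (w : ℕ → ℕ) (z : ℕ → Z) (n : ℕ) : factors w n ⊕ factors w n → Set Z :=
  Sum.elim (fun s => (fun j => z (j + n)) '' {j | OccursAt w s j})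
    (fun t => z '' {j | OccursAt w t j})

variable {T : ℕ → Z → Z} (hz : ∀ i, z (i + 1) = T (w i) (z i))

include hz in
theorem image_blockSet_succ_subset (i n : ℕ) :
    T (w i) '' blockSet w z i (n + 1) ⊆ blockSet w z (i + 1) n := by
  rintro _ ⟨_, ⟨j, hj, rfl⟩, rfl⟩
  obtain ⟨hletter, htail⟩ := List.cons_eq_cons.1 hj
  exact ⟨j + 1, htail, by rw [hz, hletter]⟩

variable [Finite Z] (hT : ∀ a, Function.Injective (T a))

include hz hT

theorem ncard_blockSet_add_le (i m n : ℕ) :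
    (blockSet w z i (m + n)).ncard ≤ (blockSet w z (i + m) n).ncard := by
  induction m generalizing i with
  | zero => rw [zero_add, add_zero]
  | succ m ih =>
    calc (blockSet w z i (m + 1 + n)).ncard
        = (T (w i) '' blockSet w z i (m + n + 1)).ncard := by
          rw [Set.ncard_image_of_injective _ (hT _), add_right_comm]
      _ ≤ (blockSet w z (i + 1) (m + n)).ncard :=
          Set.ncard_le_ncard (image_blockSet_succ_subset hz i (m + n))
      _ ≤ (blockSet w z (i + (m + 1)) n).ncard := by
          rw [← add_assoc, add_right_comm]
          exact ih (i + 1)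

theorem exists_ncard_blockSet_eq (hw : IsUniformlyRecurrent w) :
    ∃ n₀ c, ∀ n ≥ n₀, ∀ i, (blockSet w z i n).ncard = c := by
  let card : ℕ × ℕ → ℕ := fun a => (blockSet w z a.1 a.2).ncard
  obtain ⟨⟨i₁, n₁⟩, hmin⟩ : ∃ a, ∀ b, card a ≤ card b :=
    ⟨Function.argmin card, fun b => Function.argmin_le card b⟩
  obtain ⟨D, hD⟩ := hw.exists_block_eq i₁ n₁
  refine ⟨D + n₁, (blockSet w z i₁ n₁).ncard, fun n hn i => (hmin (i, n)).antisymm' ?_⟩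
  obtain ⟨m, hm, hblock⟩ := hD i
  calc (blockSet w z i n).ncard
      ≤ (blockSet w z i (m + n₁)).ncard :=
        Set.ncard_le_ncard (blockSet_antitone i (by omega))
    _ ≤ (blockSet w z (i + m) n₁).ncard := ncard_blockSet_add_le hz hT i m n₁
    _ = (blockSet w z i₁ n₁).ncard := by rw [blockSet_congr hblock]

theorem exists_blockSet_eq_fiber (hw : IsUniformlyRecurrent w) :
    ∃ n₀, ∀ n ≥ n₀, ∀ i, blockSet w z i n = fiber w z i := by
  obtain ⟨n₀, c, hc⟩ := exists_ncard_blockSet_eq hz hT hw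
  refine ⟨n₀, fun n hn i => subset_antisymm (Set.subset_iInter fun k => ?_)
    (Set.iInter_subset _ n)⟩
  calc blockSet w z i n
      = blockSet w z i (max n k) :=
        (Set.eq_of_subset_of_ncard_le (blockSet_antitone i (le_max_left n k))
          (by rw [hc n hn, hc _ (hn.trans (le_max_left n k))])).symm
    _ ⊆ blockSet w z i k := blockSet_antitone i (le_max_right n k)

theorem image_fiber (hw : IsUniformlyRecurrent w) (i : ℕ) :
    T (w i) '' fiber w z i = fiber w z (i + 1) := by
  obtain ⟨n₁, c, hc⟩ := exists_ncard_blockSet_eq hz hT hw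
  obtain ⟨n₂, hn₂⟩ := exists_blockSet_eq_fiber hz hT hw
  rw [← hn₂ (max n₁ n₂ + 1) (by omega) i, ← hn₂ (max n₁ n₂) (by omega) (i + 1)]
  refine Set.eq_of_subset_of_ncard_le (image_blockSet_succ_subset hz i _) ?_
  rw [Set.ncard_image_of_injective _ (hT _), hc _ (by omega), hc _ (by omega)]

theorem image_shift_eq_fiber (hw : IsUniformlyRecurrent w) {i m n : ℕ} (hmn : m ≤ n)
    (hn : blockSet w z i n = fiber w z i) :
    (fun j => z (j + m)) '' {j | block w j n = block w i n} = fiber w z (i + m) := by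
  induction m with
  | zero => exact hn
  | succ m ih =>
    rw [← add_assoc, ← image_fiber hz hT hw, ← ih (by omega), Set.image_image]
    refine Set.image_congr fun j hj => ?_
    rw [← add_assoc, hz, apply_add_eq_of_block_eq hj hmn]

theorem boundaryColor_eq_of_isFactor (hw : IsUniformlyRecurrent w) {n : ℕ}
    (hn : ∀ i, blockSet w z i n = fiber w z i) {s t : factors w n} (hst : IsFactor w (s.1 ++ t.1)) :
    boundaryColor w z n (Sum.inl s) = boundaryColor w z n (Sum.inr t) := by
  obtain ⟨i, hi⟩ := hst
  rw [occursAt_iff_block_eq, List.length_append, s.2.1, t.2.1, block_add] at hi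
  obtain ⟨hs, ht⟩ := List.append_inj hi (by rw [length_block, s.2.1])
  simp only [boundaryColor, Sum.elim_inl, Sum.elim_inr, ← hs, ← ht, occursAt_iff_block_eq,
    length_block]
  exact (image_shift_eq_fiber hz hT hw le_rfl (hn i)).trans (hn (i + n)).symm

theorem boundaryColor_eq_of_reachable (hw : IsUniformlyRecurrent w) {n : ℕ}
    (hn : ∀ i, blockSet w z i n = fiber w z i) {x y : factors w n ⊕ factors w n}
    (hxy : (factorGraph w n).Reachable x y) :
    boundaryColor w z n x = boundaryColor w z n y := by
  obtain ⟨path⟩ := hxy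
  induction path with
  | nil => rfl
  | cons hadj _ ih =>
    rw [← ih]
    rcases hadj with ⟨s, t, rfl, rfl, hst⟩ | ⟨s, t, rfl, rfl, hst⟩
    · exact boundaryColor_eq_of_isFactor hz hT hw hn hst
    · exact (boundaryColor_eq_of_isFactor hz hT hw hn hst).symm

theorem exists_encard_range_fiber_le (hw : IsUniformlyRecurrent w) :
    ∃ n, (Set.range (fiber w z)).encard ≤ ENat.card (factorGraph w n).ConnectedComponent := by
  obtain ⟨n, hn⟩ := exists_blockSet_eq_fiber hz hT hw
  replace hn := hn n le_rfl
  let color : (factorGraph w n).ConnectedComponent → Set Z :=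
    SimpleGraph.ConnectedComponent.lift (boundaryColor w z n)
      fun _ _ path _ => boundaryColor_eq_of_reachable hz hT hw hn path.reachable
  have hrange : Set.range (fiber w z) ⊆ Set.range color := by
    rintro _ ⟨i, rfl⟩
    refine ⟨SimpleGraph.connectedComponentMk _ (Sum.inr ⟨_, block_mem_factors w i n⟩), ?_⟩
    simp only [← hn, color, SimpleGraph.ConnectedComponent.lift_mk, boundaryColor, Sum.elim_inr,
      occursAt_iff_block_eq, length_block, blockSet]
  refine ⟨n, (Set.encard_le_encard hrange).trans ?_⟩
  rw [← Set.image_univ, ← Set.encard_univ]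
  exact Set.encard_image_le color Set.univ

end Fiber

section Refine

variable {ι : Type*} {β : ℕ → Type*} {F : ∀ k, ι → β k}
  (hF : ∀ ⦃k k' i j⦄, k ≤ k' → F k' i = F k' j → F k i = F k j) {C : ℕ}
  (hC : ∀ k, (Set.range (F k)).encard ≤ C)

include hF hC

theorem finite_range_swap : (Set.range (Function.swap F)).Finite := by
  by_contra hinf
  obtain ⟨A, hA, hcard⟩ := Set.Infinite.exists_subset_card_eq hinf (C + 1)
  -- Two different families differ in all sufficiently late coordinates.
  have hsep : ∀ᶠ k in Filter.atTop, ∀ a ∈ A, ∀ b ∈ A, a k = b k → a = b := by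
    simp only [Filter.eventually_all_finset]
    intro a ha b hb
    obtain ⟨i, rfl⟩ := hA ha
    obtain ⟨j, rfl⟩ := hA hb
    by_cases hij : Function.swap F i = Function.swap F j
    · exact Filter.Eventually.of_forall fun _ _ => hij
    · obtain ⟨k₀, hk₀⟩ := Function.ne_iff.1 hij
      filter_upwards [Filter.eventually_ge_atTop k₀] with k hk h
      exact absurd (hF hk h) hk₀
  obtain ⟨k, hk⟩ := hsep.exists
  have hle : (A.card : ℕ∞) ≤ C :=
    calc (A.card : ℕ∞) = ((fun a => a k) '' (A : Set (∀ k, β k))).encard := by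
          rw [Set.InjOn.encard_image fun a ha b hb => hk a ha b hb,
            Set.encard_coe_eq_coe_finsetCard]
      _ ≤ (Set.range (F k)).encard := Set.encard_le_encard (by
          rintro _ ⟨a, ha, rfl⟩
          obtain ⟨i, rfl⟩ := hA ha
          exact ⟨i, rfl⟩)
      _ ≤ C := hC k
  have := Nat.cast_le.1 hle
  omega

theorem exists_infinite_forall_eq [Infinite ι] :
    ∃ Q : Set ι, Q.Infinite ∧ ∀ i ∈ Q, ∀ j ∈ Q, ∀ k, F k i = F k j := by
  have := (finite_range_swap hF hC).to_subtype
  obtain ⟨c, hc⟩ := Finite.exists_infinite_fiber (Set.rangeFactorization (Function.swap F))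
  refine ⟨Set.rangeFactorization (Function.swap F) ⁻¹' {c}, Set.infinite_coe_iff.1 hc, ?_⟩
  exact fun i hi j hj k => congrFun (congrArg Subtype.val (hi.trans hj.symm)) k

end Refine

/-! ### Products of the matrices of the letters -/

/-- The integral form of the matrix `A_a`. -/
def letterMat (a : ℕ) : Matrix (Fin 2) (Fin 2) ℤ := !![0, 1; 1, (a : ℤ)]

/-- The matrix `A_{aₙ} ⋯ A_{a₁}` by which the word `a₁ … aₙ` acts. -/
def wordMat : List ℕ → Matrix (Fin 2) (Fin 2) ℤ
  | [] => 1
  | a :: l => wordMat l * letterMat a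

section WordMat

variable {l l' : List ℕ}

theorem wordMat_append (l l' : List ℕ) : wordMat (l ++ l') = wordMat l' * wordMat l := by
  induction l with
  | nil => rw [List.nil_append, wordMat, mul_one]
  | cons a l ih => rw [List.cons_append, wordMat, wordMat, ih, mul_assoc]

theorem wordMat_flatten_replicate (m : ℕ) (l : List ℕ) :
    wordMat (List.replicate m l).flatten = wordMat l ^ m := by
  induction m with
  | zero => rfl
  | succ m ih => rw [List.replicate_succ, List.flatten_cons, wordMat_append, ih, pow_succ]

theorem isUnit_det_letterMat (a : ℕ) : IsUnit (letterMat a).det := by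
  simp [letterMat, Matrix.det_fin_two_of]

theorem isUnit_det_wordMat (l : List ℕ) : IsUnit (wordMat l).det := by
  induction l with
  | nil => rw [wordMat, Matrix.det_one]; exact isUnit_one
  | cons a l ih => rw [wordMat, Matrix.det_mul]; exact ih.mul (isUnit_det_letterMat a)

theorem wordMat_cons_apply_zero (a : ℕ) (l : List ℕ) (i : Fin 2) :
    wordMat (a :: l) i 0 = wordMat l i 1 := by
  simp [wordMat, letterMat, Matrix.mul_apply]

theorem wordMat_cons_apply_one (a : ℕ) (l : List ℕ) (i : Fin 2) :
    wordMat (a :: l) i 1 = wordMat l i 0 + a * wordMat l i 1 := by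
  simp [wordMat, letterMat, Matrix.mul_apply, mul_comm]

/-- The sum of the entries of `wordMat l` in the column `j`. -/
def colSum (l : List ℕ) (j : Fin 2) : ℤ := wordMat l 0 j + wordMat l 1 j

theorem colSum_cons_zero (a : ℕ) (l : List ℕ) : colSum (a :: l) 0 = colSum l 1 := by
  simp only [colSum, wordMat_cons_apply_zero]

theorem colSum_cons_one (a : ℕ) (l : List ℕ) :
    colSum (a :: l) 1 = colSum l 0 + a * colSum l 1 := by
  simp only [colSum, wordMat_cons_apply_one]
  ring

theorem colSum_pos_and_le (hl : ∀ a ∈ l, 1 ≤ a) : 0 < colSum l 0 ∧ colSum l 0 ≤ colSum l 1 := by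
  induction l with
  | nil => simp [colSum, wordMat]
  | cons a l ih =>
    obtain ⟨ha, hl⟩ := List.forall_mem_cons.1 hl
    obtain ⟨hpos, hle⟩ := ih hl
    rw [colSum_cons_zero, colSum_cons_one]
    have : (1 : ℤ) ≤ a := by exact_mod_cast ha
    constructor <;> nlinarith

theorem colSum_zero_lt_one (hne : l ≠ []) (hl : ∀ a ∈ l, 1 ≤ a) : colSum l 0 < colSum l 1 := by
  obtain ⟨a, l, rfl⟩ := List.exists_cons_of_ne_nil hne
  obtain ⟨ha, hl⟩ := List.forall_mem_cons.1 hl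
  obtain ⟨hpos, hle⟩ := colSum_pos_and_le hl
  rw [colSum_cons_zero, colSum_cons_one]
  have : (1 : ℤ) ≤ a := by exact_mod_cast ha
  nlinarith

theorem wordMat_ne_intCast (hne : l ≠ []) (hl : ∀ a ∈ l, 1 ≤ a) (c : ℤ) : wordMat l ≠ c := by
  intro h
  refine (colSum_zero_lt_one hne hl).ne ?_
  simp [colSum, h, Matrix.intCast_apply]

theorem wordMat_pow_ne_intCast (hne : l ≠ []) (hl : ∀ a ∈ l, 1 ≤ a) {m : ℕ} (hm : m ≠ 0)
    (c : ℤ) : wordMat l ^ m ≠ c := by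
  rw [← wordMat_flatten_replicate]
  refine wordMat_ne_intCast ?_ ?_ c
  · simp [List.flatten_eq_nil_iff, List.mem_replicate, hm, hne]
  · simpa [List.mem_flatten, List.mem_replicate, hm] using hl

theorem wordMat_eq_one_iff (hl : ∀ a ∈ l, 1 ≤ a) : wordMat l = 1 ↔ l = [] := by
  refine ⟨fun h => ?_, fun h => by rw [h, wordMat]⟩
  by_contra hne
  exact wordMat_ne_intCast hne hl 1 (by rw [h, Int.cast_one])

theorem wordMat_cons_inj {a b : ℕ} (hl : ∀ a ∈ l, 1 ≤ a) (hl' : ∀ a ∈ l', 1 ≤ a)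
    (h : wordMat (a :: l) = wordMat (b :: l')) : a = b ∧ wordMat l = wordMat l' := by
  obtain ⟨hpos, hle⟩ := colSum_pos_and_le hl
  obtain ⟨hpos', hle'⟩ := colSum_pos_and_le hl'
  have hcol : ∀ i, wordMat l i 1 = wordMat l' i 1 := fun i => by
    rw [← wordMat_cons_apply_zero a, h, wordMat_cons_apply_zero]
  have hcolSum : colSum l 1 = colSum l' 1 := by simp only [colSum, hcol]
  have hdiv : colSum l 0 + a * colSum l 1 = colSum l' 0 + b * colSum l 1 := by
    rw [← colSum_cons_one, hcolSum, ← colSum_cons_one]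
    simp only [colSum, h]
  -- Both sides of `hdiv` are divisions by `colSum l 1` with remainder in `(0, colSum l 1]`.
  have hab : (a : ℤ) = b := by
    rcases lt_trichotomy (a : ℤ) b with hlt | heq | hlt
    · nlinarith
    · exact heq
    · nlinarith
  refine ⟨Nat.cast_injective hab, ?_⟩
  ext i j
  fin_cases j
  · have hentry := congrFun (congrFun h i) 1
    rw [wordMat_cons_apply_one, wordMat_cons_apply_one, hab, hcol] at hentry
    exact add_right_cancel hentry
  · exact hcol i

theorem wordMat_injOn : Set.InjOn wordMat {l | ∀ a ∈ l, 1 ≤ a} := by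
  intro l hl l' hl' h
  induction l generalizing l' with
  | nil => exact ((wordMat_eq_one_iff hl').1 h.symm).symm
  | cons a l ih =>
    cases l' with
    | nil => exact (wordMat_eq_one_iff hl).1 h
    | cons b l' =>
      replace hl := (List.forall_mem_cons.1 hl).2
      replace hl' := (List.forall_mem_cons.1 hl').2
      obtain ⟨hab, hmat⟩ := wordMat_cons_inj hl hl' h
      rw [hab, ih hl hl' hmat]

theorem append_comm_of_commute_wordMat (hl : ∀ a ∈ l, 1 ≤ a) (hl' : ∀ a ∈ l', 1 ≤ a)
    (h : Commute (wordMat l) (wordMat l')) : l ++ l' = l' ++ l := by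
  refine wordMat_injOn (List.forall_mem_append.2 ⟨hl, hl'⟩) (List.forall_mem_append.2 ⟨hl', hl⟩) ?_
  rw [wordMat_append, wordMat_append, h.eq]

end WordMat

theorem block_add_eq_of_append_comm {w : ℕ → ℕ} {i m n : ℕ}
    (h : block w i m ++ block w i (m + n) = block w i (m + n) ++ block w i m) :
    block w (i + m) n = block w i n := by
  rw [block_add w i m n, List.append_assoc, List.append_cancel_left_eq, ← block_add, add_comm m,
    block_add] at h
  exact (List.append_inj_left h (by simp only [length_block])).symm

/-! ### Integer matrices acting on vectors -/

section IntAct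

variable {R S : Type*} [CommRing R] [CommRing S]

/-- The action of the integer matrices on the column vectors over `R`. -/
noncomputable def intAct (R : Type*) [CommRing R] :
    Matrix (Fin 2) (Fin 2) ℤ →+* Module.End R (Fin 2 → R) :=
  (Matrix.toLinAlgEquiv' : _ ≃ₐ[R] Module.End R (Fin 2 → R)).toRingEquiv.toRingHom.comp
    (Int.castRingHom R).mapMatrix

/-- The linear form with integral coefficients `r`. -/
def intForm (r : Fin 2 → ℤ) : (Fin 2 → R) →ₗ[R] R :=
  (r 0 : R) • LinearMap.proj 0 + (r 1 : R) • LinearMap.proj 1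

/-- The determinant of the matrix with columns `v` and `u`; it vanishes if `v` and `u` are
proportional. -/
def cross (v u : Fin 2 → R) : R := v 0 * u 1 - v 1 * u 0

theorem intAct_apply (M : Matrix (Fin 2) (Fin 2) ℤ) (v : Fin 2 → R) (i : Fin 2) :
    intAct R M v i = M i 0 * v 0 + M i 1 * v 1 := by
  simp [intAct, Matrix.mulVec, dotProduct, Fin.sum_univ_two]

theorem intForm_apply (r : Fin 2 → ℤ) (v : Fin 2 → R) :
    intForm r v = r 0 * v 0 + r 1 * v 1 := by
  simp [intForm]

theorem map_intAct (f : R →+* S) (M : Matrix (Fin 2) (Fin 2) ℤ) (v : Fin 2 → R) :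
    f ∘ intAct R M v = intAct S M (f ∘ v) := by
  ext i
  simp [intAct_apply]

theorem map_intForm (f : R →+* S) (r : Fin 2 → ℤ) (v : Fin 2 → R) :
    f (intForm r v) = intForm r (f ∘ v) := by
  simp [intForm_apply]

theorem intAct_inv_apply {M : Matrix (Fin 2) (Fin 2) ℤ} (hM : IsUnit M.det) (v : Fin 2 → R) :
    intAct R M⁻¹ (intAct R M v) = v := by
  rw [← Module.End.mul_apply, ← map_mul, Matrix.nonsing_inv_mul _ hM, map_one, Module.End.one_apply]

theorem intAct_injective {M : Matrix (Fin 2) (Fin 2) ℤ} (hM : IsUnit M.det) :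
    Function.Injective (intAct R M) :=
  Function.LeftInverse.injective (intAct_inv_apply hM)

theorem cross_intAct_add_mul (a b : ℤ) (M : Matrix (Fin 2) (Fin 2) ℤ) (v : Fin 2 → R) :
    cross v (intAct R (a + b * M) v) = b * cross v (intAct R M v) := by
  simp only [map_add, map_mul, map_intCast, LinearMap.add_apply, Module.End.mul_apply,
    Module.End.intCast_apply, cross, Pi.add_apply, zsmul_eq_mul, Pi.mul_apply,
    Pi.intCast_apply]
  ring

theorem exists_aeval_eq (M : Matrix (Fin 2) (Fin 2) R) (P : R[X]) :
    ∃ a b : R, Polynomial.aeval M P = algebraMap R _ a + algebraMap R _ b * M := by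
  nontriviality R
  have hdeg : (P %ₘ M.charpoly).degree ≤ 1 := by
    have := Polynomial.degree_modByMonic_lt P M.charpoly_monic
    rw [Matrix.charpoly_degree_eq_dim, Fintype.card_fin] at this
    exact Order.le_of_lt_succ this
  refine ⟨(P %ₘ M.charpoly).coeff 0, (P %ₘ M.charpoly).coeff 1, ?_⟩
  rw [Matrix.aeval_eq_aeval_mod_charpoly]
  nth_rw 1 [Polynomial.eq_X_add_C_of_degree_le_one hdeg]
  rw [map_add, map_mul, Polynomial.aeval_X, Polynomial.aeval_C, Polynomial.aeval_C,
    add_comm]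

theorem commute_of_cross_eq_zero [IsDomain R] {M M' : Matrix (Fin 2) (Fin 2) ℤ} {v : Fin 2 → R}
    (hv : ∀ r : Fin 2 → ℤ, r ≠ 0 → intForm r v ≠ 0) (hM : cross v (intAct R M v) = 0)
    (hM' : cross v (intAct R M' v) = 0) : Commute M M' := by
  have hv₀ : v 0 ≠ 0 := by
    simpa [intForm_apply] using hv ![1, 0] (fun h => by simpa using congrFun h 0)
  have hv₁ : v 1 ≠ 0 := by
    simpa [intForm_apply] using hv ![0, 1] (fun h => by simpa using congrFun h 1)
  simp only [cross, intAct_apply] at hM hM'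
  have hrow : ∀ i, intForm ((M * M' - M' * M) i) v = 0 := by
    simp only [Fin.forall_fin_two, intForm_apply, Matrix.sub_apply, Matrix.mul_apply,
      Fin.sum_univ_two, Int.cast_sub, Int.cast_add, Int.cast_mul]
    constructor
    · refine mul_left_cancel₀ hv₀ ?_
      linear_combination M 0 1 * hM' - M' 0 1 * hM
    · refine mul_left_cancel₀ hv₁ ?_
      linear_combination M' 1 0 * hM - M 1 0 * hM'
  have hzero : M * M' - M' * M = 0 := funext fun i => by
    by_contra hne
    exact hv _ hne (hrow i)
  exact sub_eq_zero.1 hzero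

end IntAct

/-! ### `p`-adic values of linear forms at the powers of a matrix -/

section Powers

theorem exists_one_add_pow_mul_pow_eq {R : Type*} [CommRing R] (p : ℕ) (x : R) (h : ℕ) :
    ∃ q, (1 + (p : R) ^ 2 * x) ^ p ^ h = 1 + (p : R) ^ (h + 2) * (x * (1 + p * q)) := by
  induction h with
  | zero => exact ⟨0, by simp⟩
  | succ h ih =>
    obtain ⟨q, hq⟩ := ih
    obtain ⟨k, hk⟩ := Polynomial.powAddExpansion (1 : R)
      ((p : R) ^ (h + 2) * (x * (1 + p * q))) p
    refine ⟨q + p ^ h * (x * (1 + p * q) ^ 2 * k), ?_⟩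
    rw [pow_succ p h, pow_mul, hq, hk]
    simp only [one_pow]
    ring

variable {p : ℕ} [Fact p.Prime]

/-- The digits of `l` in base `p` are chosen one at a time. -/
theorem exists_pow_mul_dvd {f : ℕ → ℤ_[p]} {ρ : ℤ_[p]} (h₀ : ρ ∣ f 0)
    (hstep : ∀ h l, ∃ e, f (l + p ^ h) = f l + p ^ h * ρ * (1 + p * e)) (h : ℕ) :
    ∃ l, (p : ℤ_[p]) ^ h * ρ ∣ f l := by
  induction h with
  | zero => exact ⟨0, by rwa [pow_zero, one_mul]⟩
  | succ h ih =>
    obtain ⟨l, c, hc⟩ := ih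
    have hsteps : ∀ j : ℕ, ∃ e, f (l + j * p ^ h) = p ^ h * ρ * (c + j + p * e) := by
      intro j
      induction j with
      | zero => exact ⟨0, by simpa using hc⟩
      | succ j ih =>
        obtain ⟨e, he⟩ := ih
        obtain ⟨e', he'⟩ := hstep h (l + j * p ^ h)
        refine ⟨e + e', ?_⟩
        rw [add_one_mul, ← add_assoc, he', he]
        push_cast
        ring
    obtain ⟨j, -, hj⟩ := PadicInt.exists_mem_range (-c)
    rw [PadicInt.maximalIdeal_eq_span_p, Ideal.mem_span_singleton] at hj
    obtain ⟨b, hb⟩ := hj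
    obtain ⟨e, he⟩ := hsteps j
    refine ⟨l + j * p ^ h, e - b, ?_⟩
    rw [he]
    linear_combination (-(p : ℤ_[p]) ^ h * ρ) * hb

theorem exists_pow_dvd_apply_pow {R : Type*} [CommRing R] (L : R →+ ℤ_[p]) (x : R)
    (hL : ∀ y, L x ∣ L y) (h₁ : (p : ℤ_[p]) ^ 2 * L x ∣ L 1) (h : ℕ) :
    ∃ l, (p : ℤ_[p]) ^ h ∣ L ((1 + (p : R) ^ 2 * x) ^ l) := by
  have hmul : ∀ (k : ℕ) (y : R), L ((p : R) ^ k * y) = (p : ℤ_[p]) ^ k * L y := fun k y => by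
    simpa only [nsmul_eq_mul, Nat.cast_pow] using map_nsmul L (p ^ k) y
  have hstep : ∀ h l, ∃ e, L ((1 + (p : R) ^ 2 * x) ^ (l + p ^ h)) =
      L ((1 + (p : R) ^ 2 * x) ^ l) + p ^ h * (p ^ 2 * L x) * (1 + p * e) := fun h l => by
    obtain ⟨q, hq⟩ := exists_one_add_pow_mul_pow_eq p x h
    obtain ⟨y, hy⟩ : (p : R) ^ 2 * x ∣ (1 + (p : R) ^ 2 * x) ^ l - 1 := by
      have := sub_one_dvd_pow_sub_one (1 + (p : R) ^ 2 * x) l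
      rwa [add_sub_cancel_left] at this
    obtain ⟨e, he⟩ := hL (x * (q + p * x * y * (1 + p * q)))
    refine ⟨e, ?_⟩
    have hsplit : (1 + (p : R) ^ 2 * x) ^ (l + p ^ h) = (1 + (p : R) ^ 2 * x) ^ l +
        (p : R) ^ (h + 2) * x + (p : R) ^ (h + 3) * (x * (q + p * x * y * (1 + p * q))) := by
      rw [pow_add, hq]
      linear_combination (p : R) ^ (h + 2) * (x * (1 + p * q)) * hy
    rw [hsplit, map_add, map_add, hmul, hmul, he]
    ring
  obtain ⟨l, hl⟩ := exists_pow_mul_dvd (f := fun l => L ((1 + (p : R) ^ 2 * x) ^ l))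
    (by simpa only [pow_zero] using h₁) hstep h
  exact ⟨l, (dvd_mul_right _ _).trans hl⟩

theorem isUnit_one_add_p_mul (x : ℤ_[p]) : IsUnit (1 + p * x) := by
  have hmem : -(p * x) ∈ nonunits ℤ_[p] := by
    rw [← IsLocalRing.mem_maximalIdeal, PadicInt.maximalIdeal_eq_span_p, Ideal.mem_span_singleton,
      dvd_neg]
    exact dvd_mul_right _ x
  simpa only [sub_neg_eq_add] using IsLocalRing.isUnit_one_sub_self_of_mem_nonunits _ hmem

theorem exists_intCast_eq_add_mul {d : ℤ_[p]} (hd : d ≠ 0) (a : ℤ_[p]) :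
    ∃ (b : ℤ) (e : ℤ_[p]), (b : ℤ_[p]) = a + d * e := by
  have hdvd : d ∣ p ^ d.valuation :=
    ((PadicInt.unitCoeff hd).isUnit.dvd_mul_left.1 (PadicInt.unitCoeff_spec hd).dvd)
  obtain ⟨e, he⟩ := hdvd.trans (Ideal.mem_span_singleton.1 (PadicInt.appr_spec d.valuation a))
  exact ⟨a.appr d.valuation, -e, by push_cast; linear_combination -he⟩

/-- The form `r` is an integral approximation of the form `cross v`. -/
theorem exists_intForm_approx {v y : Fin 2 → ℤ_[p]} (hvy : cross v y ≠ 0) :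
    ∃ r : Fin 2 → ℤ, Associated (cross v y) (intForm r y) ∧
      (p : ℤ_[p]) ^ 2 * cross v y ∣ intForm r v := by
  have hd : (p : ℤ_[p]) ^ 2 * cross v y ≠ 0 :=
    mul_ne_zero (pow_ne_zero 2 PadicInt.prime_p.ne_zero) hvy
  obtain ⟨r₀, e₀, h₀⟩ := exists_intCast_eq_add_mul hd (-v 1)
  obtain ⟨r₁, e₁, h₁⟩ := exists_intCast_eq_add_mul hd (v 0)
  refine ⟨![r₀, r₁], ⟨(isUnit_one_add_p_mul ((p : ℤ_[p]) * (e₀ * y 0 + e₁ * y 1))).unit, ?_⟩,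
    ⟨e₀ * v 0 + e₁ * v 1, ?_⟩⟩
  · simp only [IsUnit.unit_spec, intForm_apply, Matrix.cons_val_zero, Matrix.cons_val_one, h₀, h₁]
    simp only [cross]
    ring
  · simp only [intForm_apply, Matrix.cons_val_zero, Matrix.cons_val_one, h₀, h₁]
    ring

theorem exists_pow_dvd_intForm_pow {Y : Matrix (Fin 2) (Fin 2) ℤ} {v : Fin 2 → ℤ_[p]}
    (hY : cross v (intAct ℤ_[p] Y v) ≠ 0) :
    ∃ r : Fin 2 → ℤ, r ≠ 0 ∧ ∀ h, ∃ l, (p : ℤ_[p]) ^ h ∣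
      intForm r (intAct ℤ_[p] ((1 + (p : Matrix (Fin 2) (Fin 2) ℤ) ^ 2 * Y) ^ l) v) := by
  obtain ⟨r, hassoc, hr₁⟩ := exists_intForm_approx hY
  rw [(hassoc.mul_left _).dvd_iff_dvd_left] at hr₁
  refine ⟨r, fun hr => ?_, fun h => ?_⟩
  · refine hY (hassoc.eq_zero_iff.2 ?_)
    rw [hr, intForm_apply]
    simp
  let L : ℤ[X] →+ ℤ_[p] := AddMonoidHom.mk'
    (fun P => intForm r (intAct ℤ_[p] (Polynomial.aeval Y P) v)) fun P Q => by
      rw [map_add, map_add, LinearMap.add_apply, map_add]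
  have hLX : L Polynomial.X = intForm r (intAct ℤ_[p] Y v) := by simp [L]
  have hL₁ : L 1 = intForm r v := by simp [L]
  have hL : ∀ P, L Polynomial.X ∣ L P := by
    intro P
    obtain ⟨a, b, hab⟩ := exists_aeval_eq Y P
    have hP : L P = a * L 1 + b * L Polynomial.X := by
      rw [hLX, hL₁]
      simp [L, hab, intForm_apply]
      ring
    rw [hP, hLX, hL₁]
    exact dvd_add (((dvd_mul_left _ _).trans hr₁).mul_left _) (dvd_mul_left _ _)
  obtain ⟨l, hl⟩ := exists_pow_dvd_apply_pow L Polynomial.X hL (by rwa [hLX, hL₁]) h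
  exact ⟨l, by simpa [L] using hl⟩

theorem exists_pow_eq_one_add_mul {ι : Type*} [Fintype ι] [DecidableEq ι] {M : Matrix ι ι ℤ}
    (hM : IsUnit M.det) {n : ℕ} (hn : n ≠ 0) :
    ∃ m ≠ 0, ∃ Y, M ^ m = 1 + (n : Matrix ι ι ℤ) * Y := by
  have : NeZero n := ⟨hn⟩
  let f := (Int.castRingHom (ZMod n)).mapMatrix (m := ι)
  obtain ⟨U, hU⟩ := ((Matrix.isUnit_iff_isUnit_det M).2 hM).map f
  obtain ⟨m, hm, hUm⟩ := (isOfFinOrder_of_finite U).exists_pow_eq_one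
  have hf : f (M ^ m - 1) = 0 := by
    rw [map_sub, map_pow, ← hU, ← Units.val_pow_eq_pow_val, hUm, Units.val_one, map_one, sub_self]
  have hdvd : ∀ i j, (n : ℤ) ∣ (M ^ m - 1) i j := fun i j =>
    (ZMod.intCast_zmod_eq_zero_iff_dvd _ n).1 (congrFun (congrFun hf i) j)
  choose Y hY using hdvd
  refine ⟨m, hm.ne', Matrix.of Y, ?_⟩
  rw [← sub_eq_iff_eq_add', ← nsmul_eq_mul]
  ext i j
  rw [hY, Matrix.smul_apply, nsmul_eq_mul, Matrix.of_apply]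

theorem cross_intAct_eq_zero {M : Matrix (Fin 2) (Fin 2) ℤ} (hM : IsUnit M.det)
    (hscalar : ∀ m ≠ 0, ∀ c : ℤ, M ^ m ≠ c) {v : Fin 2 → ℤ_[p]}
    (hbad : ∀ r : Fin 2 → ℤ, r ≠ 0 → ∃ h : ℕ, ∀ e : ℕ,
      ¬ (p : ℤ_[p]) ^ h ∣ intForm r (intAct ℤ_[p] (M ^ e) v)) :
    cross v (intAct ℤ_[p] M v) = 0 := by
  obtain ⟨m, hm, Y, hY⟩ :=
    exists_pow_eq_one_add_mul hM (pow_ne_zero 2 (Fact.out : p.Prime).ne_zero)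
  rw [Nat.cast_pow] at hY
  have hYv : cross v (intAct ℤ_[p] Y v) = 0 := by
    by_contra hne
    obtain ⟨r, hr, hsmall⟩ := exists_pow_dvd_intForm_pow hne
    obtain ⟨h, hh⟩ := hbad r hr
    obtain ⟨l, hl⟩ := hsmall h
    rw [← hY, ← pow_mul] at hl
    exact hh _ hl
  have hMm : cross v (intAct ℤ_[p] (M ^ m) v) = 0 := by
    have := cross_intAct_add_mul 1 (p ^ 2) Y v
    push_cast at this
    rw [hY, this, hYv, mul_zero]
  obtain ⟨a, b, hab⟩ := exists_aeval_eq M (Polynomial.X ^ m)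
  rw [map_pow, Polynomial.aeval_X, eq_intCast, eq_intCast] at hab
  have hb : b ≠ 0 := by
    rintro rfl
    exact hscalar m hm a (by rw [hab, Int.cast_zero, zero_mul, add_zero])
  rw [hab, cross_intAct_add_mul] at hMm
  exact (mul_eq_zero.1 hMm).resolve_left (Int.cast_ne_zero.2 hb)

end Powers

/-! ### Orbits along a word -/

section Orbit

variable {R S : Type*} [CommRing R] [CommRing S] {w : ℕ → ℕ}

/-- The orbit of the vector `v` under the matrices of the successive letters of `w`. -/
noncomputable def orbit (w : ℕ → ℕ) (v : Fin 2 → R) : ℕ → Fin 2 → R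
  | 0 => v
  | n + 1 => intAct R (letterMat (w n)) (orbit w v n)

theorem map_orbit (f : R →+* S) (w : ℕ → ℕ) (v : Fin 2 → R) (n : ℕ) :
    f ∘ orbit w v n = orbit w (f ∘ v) n := by
  induction n with
  | zero => rfl
  | succ n ih => rw [orbit, orbit, map_intAct, ih]

theorem orbit_ne_zero {v : Fin 2 → R} (hv : v ≠ 0) (n : ℕ) : orbit w v n ≠ 0 := by
  induction n with
  | zero => exact hv
  | succ n ih => exact (map_ne_zero_iff _ (intAct_injective (isUnit_det_letterMat _))).2 ih

section Finite

variable [Finite R]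

theorem exists_blockSet_orbit_eq_fiber (hw : IsUniformlyRecurrent w) (v : Fin 2 → R) :
    ∃ n₀, ∀ n ≥ n₀, ∀ i, blockSet w (orbit w v) i n = fiber w (orbit w v) i :=
  exists_blockSet_eq_fiber (fun _ => rfl)
    (fun a => intAct_injective (isUnit_det_letterMat a)) hw

theorem image_fiber_orbit (hw : IsUniformlyRecurrent w) (v : Fin 2 → R) (i n : ℕ) :
    intAct R (wordMat (block w i n)) '' fiber w (orbit w v) i = fiber w (orbit w v) (i + n) := by
  have hletter : ∀ j, intAct R (letterMat (w j)) '' fiber w (orbit w v) j =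
      fiber w (orbit w v) (j + 1) :=
    image_fiber (fun _ => rfl) (fun a => intAct_injective (isUnit_det_letterMat a)) hw
  induction n generalizing i with
  | zero =>
    have : ⇑(intAct R (wordMat (block w i 0))) = id :=
      congrArg DFunLike.coe (map_one (intAct R))
    rw [this, Set.image_id, add_zero]
  | succ n ih =>
    rw [block_succ, wordMat, map_mul, Module.End.coe_mul, Set.image_comp, hletter, ih, add_assoc,
      add_comm 1]

theorem exists_orbit_eq_intAct_pow (hw : IsUniformlyRecurrent w) (v : Fin 2 → R) {i m : ℕ}
    (h : fiber w (orbit w v) i = fiber w (orbit w v) (i + m)) (e : ℕ) :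
    ∃ l, orbit w v l = intAct R (wordMat (block w i m) ^ e) (orbit w v i) := by
  have hmem : intAct R (wordMat (block w i m) ^ e) (orbit w v i) ∈ fiber w (orbit w v) i := by
    induction e with
    | zero =>
      rw [pow_zero, map_one]
      exact mem_fiber_self w _ i
    | succ e ih =>
      rw [pow_succ', map_mul, Module.End.mul_apply, h, ← image_fiber_orbit hw]
      exact Set.mem_image_of_mem _ ih
  obtain ⟨l, -, hl⟩ := Set.mem_iInter.1 hmem 0
  exact ⟨l, hl⟩

end Finite

variable {p : ℕ} [Fact p.Prime] {v : Fin 2 → ℤ_[p]}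

/-- The fibres of the orbit of `v` modulo `p ^ k`. -/
noncomputable def residueFiber (w : ℕ → ℕ) (v : Fin 2 → ℤ_[p]) (k : ℕ) :
    ℕ → Set (Fin 2 → ZMod (p ^ k)) :=
  fiber w (orbit w (PadicInt.toZModPow k ∘ v))

theorem residueFiber_eq_image (hw : IsUniformlyRecurrent w) (v : Fin 2 → ℤ_[p]) {k k' : ℕ}
    (hk : k ≤ k') (i : ℕ) :
    residueFiber w v k i =
      (ZMod.castHom (pow_dvd_pow p hk) (ZMod (p ^ k)) ∘ ·) '' residueFiber w v k' i := by
  obtain ⟨n, hn⟩ := exists_blockSet_orbit_eq_fiber hw (PadicInt.toZModPow k' ∘ v)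
  rw [residueFiber, residueFiber, ← fiber_comp _ (hn n le_rfl i)]
  congr 1
  funext j
  rw [Function.comp_apply, map_orbit, ← Function.comp_assoc, ← RingHom.coe_comp,
    PadicInt.zmod_cast_comp_toZModPow k k' hk]

theorem exists_infinite_residueFiber_eq (hw : IsUniformlyRecurrent w) {C : ℕ}
    (hC : ∀ n, ENat.card (factorGraph w n).ConnectedComponent ≤ C) (v : Fin 2 → ℤ_[p]) :
    ∃ Q : Set ℕ, Q.Infinite ∧
      ∀ i ∈ Q, ∀ j ∈ Q, ∀ k, residueFiber w v k i = residueFiber w v k j := by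
  refine exists_infinite_forall_eq (C := C) (fun k k' i j hk h => ?_) fun k => ?_
  · rw [residueFiber_eq_image hw v hk, residueFiber_eq_image hw v hk, h]
  · obtain ⟨n, hn⟩ := exists_encard_range_fiber_le
      (z := orbit w (PadicInt.toZModPow k ∘ v)) (fun _ => rfl)
      (fun a => intAct_injective (isUnit_det_letterMat a)) hw
    exact hn.trans (hC n)

theorem pow_dvd_intForm_iff {r : Fin 2 → ℤ} {h : ℕ} :
    (p : ℤ_[p]) ^ h ∣ intForm r v ↔ intForm r (PadicInt.toZModPow h ∘ v) = 0 := by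
  rw [← map_intForm, ← RingHom.mem_ker, PadicInt.ker_toZModPow, Ideal.mem_span_singleton]

variable (hw : ∀ i, 1 ≤ w i) (hrec : IsUniformlyRecurrent w)
  (hv : ∀ r : Fin 2 → ℤ, r ≠ 0 → ∃ h : ℕ, ∀ n, ¬ (p : ℤ_[p]) ^ h ∣ intForm r (orbit w v n))

include hw hrec hv

theorem cross_orbit_eq_zero {i m : ℕ} (hm : m ≠ 0)
    (h : ∀ k, residueFiber w v k i = residueFiber w v k (i + m)) :
    cross (orbit w v i) (intAct ℤ_[p] (wordMat (block w i m)) (orbit w v i)) = 0 := by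
  refine cross_intAct_eq_zero (isUnit_det_wordMat _) (fun e he => wordMat_pow_ne_intCast ?_ ?_ he)
    fun r hr => ?_
  · exact List.ne_nil_of_length_pos (by rw [length_block]; exact Nat.pos_of_ne_zero hm)
  · exact forall_mem_block hw
  · obtain ⟨k, hk⟩ := hv r hr
    refine ⟨k, fun e hdvd => ?_⟩
    obtain ⟨l, hl⟩ := exists_orbit_eq_intAct_pow hrec _ (h k) e
    rw [← map_orbit, ← map_orbit, ← map_intAct] at hl
    exact hk l (pow_dvd_intForm_iff.2 (by rw [hl, pow_dvd_intForm_iff.1 hdvd]))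

theorem isPeriodic_of_not_pow_dvd_intForm {C : ℕ}
    (hC : ∀ n, ENat.card (factorGraph w n).ConnectedComponent ≤ C) : IsPeriodic w := by
  obtain ⟨Q, hQ, hfiber⟩ := exists_infinite_residueFiber_eq hrec hC v
  obtain ⟨i, hi⟩ := hQ.nonempty
  have hcross : ∀ m ≠ 0, i + m ∈ Q →
      cross (orbit w v i) (intAct ℤ_[p] (wordMat (block w i m)) (orbit w v i)) = 0 :=
    fun m hm hmQ => cross_orbit_eq_zero hw hrec hv hm (hfiber i hi _ hmQ)
  have hirrational : ∀ r : Fin 2 → ℤ, r ≠ 0 → intForm r (orbit w v i) ≠ 0 := fun r hr hzero => by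
    obtain ⟨h, hh⟩ := hv r hr
    exact hh i (hzero ▸ dvd_zero _)
  obtain ⟨j, hj, hij⟩ := hQ.exists_gt i
  obtain ⟨m, rfl⟩ := Nat.exists_eq_add_of_lt hij
  refine hrec.1.isPeriodic (i := i) m.succ_pos fun t => ?_
  obtain ⟨k, hk, hjk⟩ := hQ.exists_gt (i + m + 1 + t)
  obtain ⟨n, rfl⟩ := Nat.exists_eq_add_of_lt hjk
  have hcomm : Commute (wordMat (block w i (m + 1))) (wordMat (block w i (m + 1 + (t + n + 1)))) :=
    commute_of_cross_eq_zero hirrational (hcross _ m.succ_ne_zero hj)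
      (hcross _ (by omega) (by convert hk using 1; omega))
  have hblock : block w (i + (m + 1)) (t + n + 1) = block w i (t + n + 1) :=
    block_add_eq_of_append_comm
      (append_comm_of_commute_wordMat (forall_mem_block hw) (forall_mem_block hw) hcomm)
  rw [add_right_comm]
  exact apply_add_eq_of_block_eq hblock (by omega)

end Orbit

/-! ### Badly approximable points -/

section PLine

variable {p : ℕ} [Fact p.Prime]

theorem norm_intAct_le (M : Matrix (Fin 2) (Fin 2) ℤ) (v : Fin 2 → ℤ_[p]) :
    ‖intAct ℤ_[p] M v‖ ≤ ‖v‖ := by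
  have hterm : ∀ i j, ‖(M i j : ℤ_[p]) * v j‖ ≤ ‖v‖ := fun i j => by
    rw [norm_mul]
    exact (mul_le_of_le_one_left (norm_nonneg _) (PadicInt.norm_le_one _)).trans
      (norm_le_pi_norm v j)
  refine (pi_norm_le_iff_of_nonneg (norm_nonneg v)).2 fun i => ?_
  rw [intAct_apply]
  exact (PadicInt.nonarchimedean _ _).trans (max_le (hterm i 0) (hterm i 1))

theorem norm_intAct {M : Matrix (Fin 2) (Fin 2) ℤ} (hM : IsUnit M.det) (v : Fin 2 → ℤ_[p]) :
    ‖intAct ℤ_[p] M v‖ = ‖v‖ := by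
  refine (norm_intAct_le M v).antisymm ?_
  conv_lhs => rw [← intAct_inv_apply hM v]
  exact norm_intAct_le M⁻¹ _

theorem norm_orbit (w : ℕ → ℕ) (v : Fin 2 → ℤ_[p]) (n : ℕ) : ‖orbit w v n‖ = ‖v‖ := by
  induction n with
  | zero => rfl
  | succ n ih => rw [orbit, norm_intAct (isUnit_det_letterMat _), ih]

theorem exists_mk_algebraMap_eq (x : PLine p) :
    ∃ (v : Fin 2 → ℤ_[p]) (hv : algebraMap ℤ_[p] ℚ_[p] ∘ v ≠ 0),
      Projectivization.mk ℚ_[p] (algebraMap ℤ_[p] ℚ_[p] ∘ v) hv = x := by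
  obtain ⟨⟨b, hb⟩, hint⟩ :=
    IsLocalization.exist_integer_multiples_of_finite (nonZeroDivisors ℤ_[p]) x.rep
  choose v hv using hint
  have hb₀ : algebraMap ℤ_[p] ℚ_[p] b ≠ 0 :=
    IsFractionRing.to_map_ne_zero_of_mem_nonZeroDivisors hb
  have hrep : algebraMap ℤ_[p] ℚ_[p] ∘ v = algebraMap ℤ_[p] ℚ_[p] b • x.rep := by
    ext i
    rw [Function.comp_apply, hv, Pi.smul_apply, algebraMap_smul]
  have hne : algebraMap ℤ_[p] ℚ_[p] ∘ v ≠ 0 := hrep ▸ smul_ne_zero hb₀ x.rep_nonzero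
  refine ⟨v, hne, ?_⟩
  conv_rhs => rw [← x.mk_rep]
  exact (Projectivization.mk_eq_mk_iff' _ _ _ _ _).2 ⟨_, hrep.symm⟩

theorem mulVecLin_matA (a : ℕ) : (matA p a).mulVecLin = intAct ℚ_[p] (letterMat a) := by
  refine LinearMap.ext fun v => funext fun i => ?_
  fin_cases i <;> simp [matA, letterMat, intAct_apply, Matrix.mulVec, dotProduct]

theorem iterate_extShift (w : ℕ → ℕ) {v : Fin 2 → ℚ_[p]} (hv : v ≠ 0) (n : ℕ) :
    (extShift p)^[n] (w, Projectivization.mk ℚ_[p] v hv) =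
      (fun t => w (n + t), Projectivization.mk ℚ_[p] (orbit w v n) (orbit_ne_zero hv n)) := by
  induction n with
  | zero => simp [orbit]
  | succ n ih =>
    rw [Function.iterate_succ_apply', ih, extShift, actA, Projectivization.map_mk]
    refine Prod.ext (funext fun t => ?_) ?_
    · exact congrArg w (add_right_comm n t 1)
    · simp only [mulVecLin_matA, add_zero, orbit]

theorem iterate_extShift_mem_PBad_iff (w : ℕ → ℕ) {v : Fin 2 → ℤ_[p]}
    (hv : algebraMap ℤ_[p] ℚ_[p] ∘ v ≠ 0) (ε : ℝ) (n : ℕ) :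
    ((extShift p)^[n] (w, Projectivization.mk ℚ_[p] _ hv)).2 ∈ PBad p ε ↔
      BadVec p ε (algebraMap ℤ_[p] ℚ_[p] ∘ orbit w v n) := by
  rw [iterate_extShift, mk_mem_PBad_iff, map_orbit]

theorem max_norm_algebraMap_comp (v : Fin 2 → ℤ_[p]) :
    max ‖(algebraMap ℤ_[p] ℚ_[p] ∘ v) 0‖ ‖(algebraMap ℤ_[p] ℚ_[p] ∘ v) 1‖ = ‖v‖ := by
  simp [Pi.norm_def, Fin.univ_succ]

theorem exists_not_pow_dvd_intForm {ε δ : ℝ} (hε : 0 < ε) (hδ : 0 < δ) {r : Fin 2 → ℤ}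
    (hr : r ≠ 0) :
    ∃ h : ℕ, ∀ v : Fin 2 → ℤ_[p], δ ≤ ‖v‖ → BadVec p ε (algebraMap ℤ_[p] ℚ_[p] ∘ v) →
      ¬ (p : ℤ_[p]) ^ h ∣ intForm r v := by
  have hr₀ : (r 0, r 1) ≠ (0, 0) := fun h => hr <| by
    ext i
    fin_cases i
    exacts [congrArg Prod.fst h, congrArg Prod.snd h]
  have hmax : 0 < max |(r 0 : ℝ)| |(r 1 : ℝ)| := by
    simpa [lt_max_iff, or_iff_not_imp_left] using hr₀
  have hp : (1 : ℝ) < p := by exact_mod_cast (Fact.out : p.Prime).one_lt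
  obtain ⟨h, hh⟩ := exists_pow_lt_of_lt_one
    (show 0 < ((max |(r 0 : ℝ)| |(r 1 : ℝ)|) ^ 2)⁻¹ * ε * δ by positivity)
    (inv_lt_one_of_one_lt₀ hp)
  refine ⟨h, fun v hv hbad hdvd => hh.not_ge ?_⟩
  have hform : ‖intForm r v‖ = ‖(r 0 : ℚ_[p]) * (algebraMap ℤ_[p] ℚ_[p] ∘ v) 0 +
      (r 1 : ℚ_[p]) * (algebraMap ℤ_[p] ℚ_[p] ∘ v) 1‖ := by
    rw [← intForm_apply, ← map_intForm]
    rfl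
  have hlower := hbad (r 0) (r 1) hr₀
  rw [← hform, max_norm_algebraMap_comp, ge_iff_le, ← div_eq_mul_inv,
    le_div_iff₀ (hδ.trans_le hv)] at hlower
  calc ((max |(r 0 : ℝ)| |(r 1 : ℝ)|) ^ 2)⁻¹ * ε * δ
      ≤ ((max |(r 0 : ℝ)| |(r 1 : ℝ)|) ^ 2)⁻¹ * ε * ‖v‖ := by gcongr
    _ ≤ ‖intForm r v‖ := hlower
    _ ≤ (p : ℝ) ^ (-h : ℤ) :=
      (PadicInt.norm_le_pow_iff_mem_span_pow _ h).2 (Ideal.mem_span_singleton.2 hdvd)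
    _ = (p : ℝ)⁻¹ ^ h := by rw [zpow_neg, zpow_natCast, inv_pow]

end PLine

end LimitWords

theorem theorem2p5_general (p : ℕ) [Fact p.Prime] {w : ℕ → ℕ} (hw : ∀ i, 1 ≤ w i)
    (hper : ¬ LimitWords.IsPeriodic w) (hrec : LimitWords.IsUniformlyRecurrent w)
    (hcomp : ∃ C : ℕ, ∀ n : ℕ,
      ENat.card (LimitWords.factorGraph w n).ConnectedComponent ≤ (C : ℕ∞))
    (x : LimitWords.PLine p) {ε : ℝ} (hε : 0 < ε) :
    ∃ n, ((LimitWords.extShift p)^[n] (w, x)).2 ∉ LimitWords.PBad p ε := by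
  by_contra! hbad
  obtain ⟨C, hC⟩ := hcomp
  obtain ⟨v, hv, rfl⟩ := LimitWords.exists_mk_algebraMap_eq x
  have hnorm : 0 < ‖v‖ := norm_pos_iff.2 fun h => hv (by rw [h]; ext; simp)
  refine hper (LimitWords.isPeriodic_of_not_pow_dvd_intForm (v := v) hw hrec (fun r hr => ?_) hC)
  obtain ⟨h, hh⟩ := LimitWords.exists_not_pow_dvd_intForm (p := p) hε hnorm hr
  refine ⟨h, fun n => hh _ (LimitWords.norm_orbit w v n).ge ?_⟩
  exact (LimitWords.iterate_extShift_mem_PBad_iff w hv ε n).1 (hbad n)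

theorem theorem2p5 (p : ℕ) [Fact p.Prime] (N : ℕ) (w : ℕ → ℕ)
    (hw : w ∈ LimitWords.wordsOver N)
    (hper : ¬ LimitWords.IsPeriodic w)
    (hrec : LimitWords.IsUniformlyRecurrent w)
    (hcomp : ∃ C : ℕ, ∀ n : ℕ,
      ENat.card (LimitWords.factorGraph w n).ConnectedComponent ≤ (C : ℕ∞)) :
    ∀ x : LimitWords.PLine p, (w, x) ∉ LimitWords.LMad p := by
  rintro x ⟨ε, hε, hx⟩
  obtain ⟨n, hn⟩ := theorem2p5_general p (fun i => (hw i).1) hper hrec hcomp x hε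
  exact hn (hx n).2
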